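/- Let $y$ be real-valued, let $T^*,T,z\in\{0,1\}$, and let $\mathbf{x}$ be covariates. The variables $(y,T,z,\mathbf{x})$ are observed, $T^*$ is not. Fix a value of $\mathbf{x}$; all probabilities and expectations below are conditional on $\mathbf{x}$, and all parameters may depend on it. The model with parameter $(c,\beta,\alpha_0,\alpha_1)$ consists of the following assumptions. 1. $y=c+\beta T^*+\varepsilon$ with $\mathbb{E}[\varepsilon]=0$; $0<\mathbb{P}(z=1)<1$ and $\mathbb{P}(T^*=1|z=1)\neq\mathbb{P}(T^*=1|z=0)$; and $\mathbb{E}[\varepsilon|z]=0$. 2. $\alpha_0=\mathbb{P}(T=1|T^*=0)=\mathbb{P}(T=1|T^*=0,z)$ and $\alpha_1=\mathbb{P}(T=0|T^*=1)=\mathbb{P}(T=0|T^*=1,z)$; $\alpha_0+\alpha_1<1$; and measurement error is non-differential: $\mathbb{E}[\varepsilon|z,T^*,T]=\mathbb{E}[\varepsilon|z,T^*]$. The sharp identified set is the set of all $(c,\beta,\alpha_0,\alpha_1)\in\mathbb{R}^4$ for which there is a joint distribution of $(y,T,T^*,z)$ that satisfies 1 and 2 with these parameter values and whose $(y,T,z)$-marginal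 is the observed one. Write $p_k=\mathbb{P}(T=1|z=k)$. Suppose that $\mathbb{E}|y|<\infty$, $0<\mathbb{P}(z=1)<1$, $0<p_k<1$ for $k=0,1$, $p_0\neq p_1$, and that for all $t,k\in\{0,1\}$ the conditional distribution function $F_{tk}$ of $y$ given $(T=t,z=k)$ is continuous. Let $F_{tk}^{-1}(u)=\inf\{q\in\mathbb{R}:F_{tk}(q)\geq u\}\in[-\infty,\infty]$ and $$\mu_k(\alpha_0)=\frac{p_k\,\mathbb{E}[y|z=k,T=1]-\alpha_0\,\mathbb{E}[y|z=k]}{p_k-\alpha_0},$$ $$r_{0k}=\frac{\alpha_1}{1-p_k}\cdot\frac{p_k-\alpha_0}{1-\alpha_0-\alpha_1},\qquad r_{1k}=\frac{1-\alpha_1}{p_k}\cdot\frac{p_k-\alpha_0}{1-\alpha_0-\alpha_1}.$$ Let $\mathcal{A}$ be the set of pairs $(\alpha_0,\alpha_1)$ with $\alpha_0,\alpha_1\geq0$ and $\alpha_0\leq p_k\leq1-\alpha_1$ for $k=0,1$. For $k$ with $\mathbb{E}[y|T=0,z=k]\neq\mathbb{E}[y|T=1,z=k]$, let $\mathcal{A}_k$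 be the set of pairs $(\alpha_0,\alpha_1)$ with $\alpha_0,\alpha_1\geq0$ and $\alpha_0<p_k<1-\alpha_1$ such that, for each $t\in\{0,1\}$ with $r_{tk}\neq0$, $$\mathbb{E}\big[y\,\big|\,y\leq F_{tk}^{-1}(r_{tk}),T=t,z=k\big]\;\leq\;\mu_k(\alpha_0)\;\leq\;\mathbb{E}\big[y\,\big|\,y>F_{tk}^{-1}(1-r_{tk}),T=t,z=k\big].$$ Then the sharp identified set for $(c,\beta,\alpha_0,\alpha_1)$ is the set of all $(c,\beta,\alpha_0,\alpha_1)$ such that $(\alpha_0,\alpha_1)\in\mathcal{A}^*$ and $$\mathbb{E}[y|z=k]=c+\beta\,\frac{p_k-\alpha_0}{1-\alpha_0-\alpha_1}\qquad\text{for }k=0,1,$$ where (i) $\mathcal{A}^*=\mathcal{A}_0\cap\mathcal{A}_1$ if $\mathbb{E}[y|T=0,z=k]\neq\mathbb{E}[y|T=1,z=k]$ for both $k=0,1$; (ii) $\mathcal{A}^*=\mathcal{A}_k\cap\mathcal{A}$ if $\mathbb{E}[y|T=0,z=k]\neq\mathbb{E}[y|T=1,z=k]$ and $\mathbb{E}[y|T=0,z=\ell]=\mathbb{E}[y|T=1,z=\ell]$,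 where $\{k,\ell\}=\{0,1\}$; (iii) $\mathcal{A}^*=\mathcal{A}$ if $\mathbb{E}[y|T=0,z=k]=\mathbb{E}[y|T=1,z=k]$ for both $k=0,1$. -/

import Mathlib

open MeasureTheory ProbabilityTheory

noncomputable section

/-- The space of observables `(y, T, z)`, where `T` and `z` are binary. -/
abbrev Obs : Type := ℝ × Fin 2 × Fin 2

/-- The space of observables together with the true regressor: `(y, T, Tstar, z)`. -/
abbrev Full : Type := ℝ × Fin 2 × Fin 2 × Fin 2

/-- The parameter `(c, β, α₀, α₁)` at a given value of the covariates. -/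
@[ext]
structure Param where
  c : ℝ
  β : ℝ
  α₀ : ℝ
  α₁ : ℝ

/-! ### Observable quantities

`P` is the conditional law of `(y, T, z)` given the covariates. -/

/-- The event `z = k`. -/
def evZ (k : Fin 2) : Set Obs := {w | w.2.2 = k}

/-- The event `T = t, z = k`. -/
def evTZ (t k : Fin 2) : Set Obs := {w | w.2.1 = t ∧ w.2.2 = k}

/-- The first-stage probability `p_k = P(T = 1 | z = k)`. -/
def firstStage (P : Measure Obs) (k : Fin 2) : ℝ := (P[|evZ k]).real {w | w.2.1 = 1}

/-- `E[y | z = k]`. -/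
def meanZ (P : Measure Obs) (k : Fin 2) : ℝ := ∫ w, w.1 ∂P[|evZ k]

/-- `E[y | T = t, z = k]`. -/
def meanTZ (P : Measure Obs) (t k : Fin 2) : ℝ := ∫ w, w.1 ∂P[|evTZ t k]

/-- The conditional distribution function `F_{tk}` of `y` given `T = t, z = k`. -/
def cdfTZ (P : Measure Obs) (t k : Fin 2) (q : ℝ) : ℝ := (P[|evTZ t k]).real {w | w.1 ≤ q}

/-- The conditional quantile function `F_{tk}⁻¹(u) = inf {q | u ≤ F_{tk}(q)}`, as an extended
real: it is `-∞` at `u = 0`, and may be `+∞` at `u = 1`. -/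
def quantileTZ (P : Measure Obs) (t k : Fin 2) (u : ℝ) : EReal :=
  sInf ((fun q : ℝ => (q : EReal)) '' {q : ℝ | u ≤ cdfTZ P t k q})

/-- `E[y | y ≤ q, T = t, z = k]`. -/
def lowerMean (P : Measure Obs) (t k : Fin 2) (q : EReal) : ℝ :=
  ∫ w, w.1 ∂P[|{w | (w.1 : EReal) ≤ q} ∩ evTZ t k]

/-- `E[y | y > q, T = t, z = k]`. -/
def upperMean (P : Measure Obs) (t k : Fin 2) (q : EReal) : ℝ :=
  ∫ w, w.1 ∂P[|{w | q < (w.1 : EReal)} ∩ evTZ t k]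

/-- `μ_k(α₀) = (p_k E[y | z = k, T = 1] - α₀ E[y | z = k]) / (p_k - α₀)`. -/
def muK (P : Measure Obs) (k : Fin 2) (α₀ : ℝ) : ℝ :=
  (firstStage P k * meanTZ P 1 k - α₀ * meanZ P k) / (firstStage P k - α₀)

/-- The mixing weights `r_{0k}` and `r_{1k}`. -/
def mixWeight (P : Measure Obs) (t k : Fin 2) (α₀ α₁ : ℝ) : ℝ :=
  (if t = 0 then α₁ / (1 - firstStage P k) else (1 - α₁) / firstStage P k) *
    ((firstStage P k - α₀) / (1 - α₀ - α₁))

/-- `α₀, α₁ ≥ 0` and `α₀ ≤ p_k ≤ 1 - α₁` for all `k`. -/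
def firstStageSet (P : Measure Obs) : Set (ℝ × ℝ) :=
  {α | 0 ≤ α.1 ∧ 0 ≤ α.2 ∧ ∀ k, α.1 ≤ firstStage P k ∧ firstStage P k ≤ 1 - α.2}

/-- The set `𝒜_k`. The inequalities are imposed for those `t` with `r_{tk} ≠ 0`; if
`r_{tk} = 0` then the truncation events have probability zero, and there is no restriction. -/
def setA (P : Measure Obs) (k : Fin 2) : Set (ℝ × ℝ) :=
  {α | 0 ≤ α.1 ∧ 0 ≤ α.2 ∧ α.1 < firstStage P k ∧ firstStage P k < 1 - α.2 ∧
    ∀ t, mixWeight P t k α.1 α.2 ≠ 0 →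
      lowerMean P t k (quantileTZ P t k (mixWeight P t k α.1 α.2)) ≤ muK P k α.1 ∧
      muK P k α.1 ≤ upperMean P t k (quantileTZ P t k (1 - mixWeight P t k α.1 α.2))}

/-- The parameters with `E[y | z = k] = c + β (p_k - α₀) / (1 - α₀ - α₁)` for all `k`,
and `(α₀, α₁) ∈ A`. -/
def paramSet (P : Measure Obs) (A : Set (ℝ × ℝ)) : Set Param :=
  {θ | (∀ k, meanZ P k =
      θ.c + θ.β * ((firstStage P k - θ.α₀) / (1 - θ.α₀ - θ.α₁))) ∧ (θ.α₀, θ.α₁) ∈ A}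

/-! ### The model and its sharp identified set

`Q` is a conditional law of `(y, T, Tstar, z)` given the covariates. -/

/-- The error term `ε = y - c - β Tstar`. -/
def err (θ : Param) (w : Full) : ℝ := w.1 - θ.c - θ.β * ((w.2.2.1 : ℕ) : ℝ)

/-- The event `z = k`. -/
def fullZ (k : Fin 2) : Set Full := {w | w.2.2.2 = k}

/-- The event `T = t`. -/
def fullT (t : Fin 2) : Set Full := {w | w.2.1 = t}

/-- The event `Tstar = s`. -/
def fullS (s : Fin 2) : Set Full := {w | w.2.2.1 = s}

/-- The law `Q` of `(y, T, Tstar, z)` satisfies all the assumptions, with parameter `θ`. -/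
structure IsModel (Q : Measure Full) (θ : Param) : Prop where
  /-- the error has a finite mean -/
  integrable_err : Integrable (err θ) Q
  /-- `E[ε] = 0` -/
  mean_err : ∫ w, err θ w ∂Q = 0
  /-- `0 < P(z = 1) < 1` -/
  z_pos : 0 < Q.real (fullZ 1)
  z_lt_one : Q.real (fullZ 1) < 1
  /-- relevance: `P(Tstar = 1 | z = 1) ≠ P(Tstar = 1 | z = 0)` -/
  relevance : (Q[|fullZ 1]).real (fullS 1) ≠ (Q[|fullZ 0]).real (fullS 1)
  /-- validity: `E[ε | z] = 0` -/
  validity : ∀ k, ∫ w, err θ w ∂Q[|fullZ k] = 0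
  /-- `α₀ = P(T = 1 | Tstar = 0)` -/
  α₀_eq : θ.α₀ = (Q[|fullS 0]).real (fullT 1)
  /-- `α₁ = P(T = 0 | Tstar = 1)` -/
  α₁_eq : θ.α₁ = (Q[|fullS 1]).real (fullT 0)
  /-- `P(T = 1 | Tstar = 0, z) = α₀`, wherever the left-hand side is defined -/
  α₀_homog : ∀ k, Q (fullS 0 ∩ fullZ k) ≠ 0 →
    (Q[|fullS 0 ∩ fullZ k]).real (fullT 1) = θ.α₀
  /-- `P(T = 0 | Tstar = 1, z) = α₁`, wherever the left-hand side is defined -/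
  α₁_homog : ∀ k, Q (fullS 1 ∩ fullZ k) ≠ 0 →
    (Q[|fullS 1 ∩ fullZ k]).real (fullT 0) = θ.α₁
  /-- limited misclassification -/
  α_sum : θ.α₀ + θ.α₁ < 1
  /-- non-differential measurement error: `E[ε | z, Tstar, T] = E[ε | z, Tstar]` almost surely -/
  nondifferential : ∀ t s k, Q (fullT t ∩ fullS s ∩ fullZ k) ≠ 0 →
    ∫ w, err θ w ∂Q[|fullT t ∩ fullS s ∩ fullZ k] = ∫ w, err θ w ∂Q[|fullS s ∩ fullZ k]

/-- The sharp identified set: the parameters for which some law of `(y, T, Tstar, z)` satisfies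
the assumptions and has `P` as its `(y, T, z)`-marginal. -/
def identifiedSet (P : Measure Obs) : Set Param :=
  {θ | ∃ Q : Measure Full, IsProbabilityMeasure Q ∧
    Q.map (fun w => ((w.1, w.2.1, w.2.2.2) : Obs)) = P ∧ IsModel Q θ}

end

noncomputable section

/-! ### Conditional laws and splitting along a binary variable -/

section General

variable {Ω : Type*} [MeasurableSpace Ω]

/-! The model constrains a joint law only through the mass and the `y`-integral of each cell `T = t,
Tstar = s, z = k` (`IsModel.cellModel`, `CellModel.isModel`). A joint law with marginal `P` amounts
to a free splitting of each observed measure on `T = t, z = k` into a `Tstar = 1` and a `Tstar = 0`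
component (`restrict_evTZ_map_toObs`, `exists_joint_of_split`).

The misclassification rates fix the mass of the `Tstar = 1` component: its share is `r_{tk}`.
Non-differential error says that `y` has the same mean in the cells `T = 0` and `T = 1` once `Tstar`
and `z` are fixed. So the rates apply to `y`-integrals as well as to masses, and solving the
resulting linear system gives `E[y | Tstar = 1, z = k] = μ_k(α₀)`. What remains is whether the law
of `y` given `T = t, z = k` has a component of weight `r_{tk}` and mean `μ_k(α₀)`. Truncation to the
lower or upper tail minimizes or maximizes the mean of such a component, and mixing the two tails
attains everything between (`truncated_means_of_split`, `exists_split_of_truncated_means`).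

If the means given `T = 0` and `T = 1` agree at `z = k`, a proportional split always works, even at
`α₀ = p_k` or `α₁ = 1 - p_k`. If they differ, these boundary values are impossible: `Tstar` would be
degenerate given `z = k`, and non-differential error would equate the two means. -/

lemma integral_cond_eq (μ : Measure Ω) (s : Set Ω) (f : Ω → ℝ) :
    ∫ ω, f ω ∂μ[|s] = (μ.real s)⁻¹ * ∫ ω in s, f ω ∂μ := by
  rw [ProbabilityTheory.cond, integral_smul_measure, ENNReal.toReal_inv, smul_eq_mul]
  rfl

lemma real_cond_eq (μ : Measure Ω) {s : Set Ω} (hs : MeasurableSet s) (t : Set Ω) :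
    (μ[|s]).real t = (μ.real s)⁻¹ * μ.real (s ∩ t) := by
  rw [measureReal_def, cond_apply hs, ENNReal.toReal_mul, ENNReal.toReal_inv]
  rfl

lemma measurableSet_fiber {X : Ω → Fin 2} (hX : Measurable X) (i : Fin 2) :
    MeasurableSet {ω | X ω = i} :=
  hX (measurableSet_singleton i)

omit [MeasurableSpace Ω] in
lemma sdiff_fiber_zero (X : Ω → Fin 2) (E : Set Ω) :
    E \ {ω | X ω = 0} = E ∩ {ω | X ω = 1} := by
  ext ω
  simp only [Set.mem_sdiff, Set.mem_inter_iff, Set.mem_ofPred_eq]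
  have : X ω = 0 ∨ X ω = 1 := by generalize X ω = i; revert i; decide
  grind

lemma measureReal_eq_add_fibers (μ : Measure Ω) [IsFiniteMeasure μ] {X : Ω → Fin 2}
    (hX : Measurable X) (E : Set Ω) :
    μ.real E = μ.real (E ∩ {ω | X ω = 0}) + μ.real (E ∩ {ω | X ω = 1}) := by
  rw [← sdiff_fiber_zero, measureReal_inter_add_sdiff (measurableSet_fiber hX 0)]

lemma setIntegral_eq_add_fibers {μ : Measure Ω} {X : Ω → Fin 2} (hX : Measurable X)
    {f : Ω → ℝ} (hf : Integrable f μ) (E : Set Ω) :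
    ∫ ω in E, f ω ∂μ =
      ∫ ω in E ∩ {ω | X ω = 0}, f ω ∂μ + ∫ ω in E ∩ {ω | X ω = 1}, f ω ∂μ := by
  rw [← sdiff_fiber_zero, integral_inter_add_sdiff (measurableSet_fiber hX 0) hf.integrableOn]

end General

/-! ### Quantile truncation and extremal components -/

section Truncation

variable {Ω : Type*} [MeasurableSpace Ω]

/-- The quantile function of `f` under `ρ`, as an extended real. -/
def quantile (ρ : Measure Ω) (f : Ω → ℝ) (u : ℝ) : EReal :=
  sInf ((fun q : ℝ => (q : EReal)) '' {q : ℝ | u ≤ ρ.real {ω | f ω ≤ q}})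

lemma measurableSet_le_ereal {f : Ω → ℝ} (hf : Measurable f) (a : EReal) :
    MeasurableSet {ω | (f ω : EReal) ≤ a} :=
  measurableSet_le hf.coe_real_ereal measurable_const

/-- An infinite quantile is harmless: `-∞` forces `r = 0` and `+∞` forces `r = 1`. At a finite
quantile, points to its left have distribution function below `r` and points to its right at least
`r`; continuity pinches the value to `r`. -/
lemma measureReal_le_quantile (ρ : Measure Ω) [IsProbabilityMeasure ρ] {f : Ω → ℝ}
    (hf : Measurable f) (hc : Continuous fun q : ℝ => ρ.real {ω | f ω ≤ q}) {r : ℝ}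
    (h0 : 0 ≤ r) (h1 : r ≤ 1) :
    ρ.real {ω | (f ω : EReal) ≤ quantile ρ f r} = r := by
  have : IsProbabilityMeasure (ρ.map f) := Measure.isProbabilityMeasure_map hf.aemeasurable
  have hcdf : ∀ q, cdf (ρ.map f) q = ρ.real {ω | f ω ≤ q} := fun q => by
    rw [cdf_eq_real, map_measureReal_apply hf measurableSet_Iic]; rfl
  have hmono : ∀ p q, p ≤ q → ρ.real {ω | f ω ≤ p} ≤ ρ.real {ω | f ω ≤ q} := fun p q hpq =>
    measureReal_mono fun ω hω => le_trans hω hpq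
  have hlower : ∀ q : ℝ, r ≤ ρ.real {ω | f ω ≤ q} → quantile ρ f r ≤ q := fun q hq =>
    sInf_le ⟨q, hq, rfl⟩
  have hupper : ∀ q : ℝ, quantile ρ f r < q → r ≤ ρ.real {ω | f ω ≤ q} := by
    intro q hq
    obtain ⟨_, ⟨p, hp, rfl⟩, hpq⟩ := sInf_lt_iff.1 hq
    exact le_trans hp (hmono p q (EReal.coe_lt_coe_iff.1 hpq).le)
  induction hq : quantile ρ f r using EReal.rec with
  | bot =>
    have : r ≤ 0 := ge_of_tendsto (tendsto_cdf_atBot (ρ.map f)) <| .of_forall fun q => by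
      rw [hcdf]; exact hupper q (hq ▸ EReal.bot_lt_coe q)
    simp [le_antisymm this h0]
  | top =>
    have : 1 ≤ r := le_of_tendsto (tendsto_cdf_atTop (ρ.map f)) <| .of_forall fun q => by
      rw [hcdf]
      by_contra! h
      exact absurd (hlower q h.le) (by simp [hq])
    simp [le_antisymm h1 this]
  | coe a =>
    simp only [EReal.coe_le_coe_iff]
    refine le_antisymm ?_ ?_
    · refine le_of_tendsto (hc.continuousWithinAt (s := Set.Iio a) (x := a)) ?_
      filter_upwards [self_mem_nhdsWithin] with q hqa
      by_contra! h
      exact absurd (hlower q h.le) (by simpa [hq] using hqa)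
    · refine ge_of_tendsto (hc.continuousWithinAt (s := Set.Ioi a) (x := a)) ?_
      filter_upwards [self_mem_nhdsWithin] with q hqa
      exact hupper q (by simpa [hq] using hqa)

lemma measureReal_quantile_lt (ρ : Measure Ω) [IsProbabilityMeasure ρ] {f : Ω → ℝ}
    (hf : Measurable f) (hc : Continuous fun q : ℝ => ρ.real {ω | f ω ≤ q}) {r : ℝ}
    (h0 : 0 ≤ r) (h1 : r ≤ 1) :
    ρ.real {ω | quantile ρ f (1 - r) < (f ω : EReal)} = r := by
  have h := measureReal_le_quantile ρ hf hc (r := 1 - r) (by linarith) (by linarith)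
  have hE : {ω | quantile ρ f (1 - r) < (f ω : EReal)}
      = {ω | (f ω : EReal) ≤ quantile ρ f (1 - r)}ᶜ := by ext; simp
  rw [hE, probReal_compl_eq_one_sub (measurableSet_le_ereal hf _), h]
  ring

/-- Among the measures of a given mass dominated by `ρ`, the lower truncation of `ρ` has the
least integral. -/
lemma setIntegral_le_integral_of_le {ρ ν : Measure Ω} [IsFiniteMeasure ρ] {f : Ω → ℝ}
    (hf : Measurable f) (hint : Integrable f ρ) (hle : ν ≤ ρ) (a : EReal)
    (hmass : ν.real Set.univ = ρ.real {ω | (f ω : EReal) ≤ a}) :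
    ∫ ω in {ω | (f ω : EReal) ≤ a}, f ω ∂ρ ≤ ∫ ω, f ω ∂ν := by
  have : IsFiniteMeasure ν := isFiniteMeasure_of_le ρ hle
  have hintν : Integrable f ν := hint.mono_measure hle
  have hA := measurableSet_le_ereal hf a
  induction a using EReal.rec with
  | bot =>
    have : ν = 0 := by
      rw [← Measure.measure_univ_eq_zero, ← measureReal_eq_zero_iff, hmass]; simp
    simp [this]
  | top =>
    have : ν = ρ := Measure.eq_of_le_of_measure_univ_eq hle <| by
      rw [← ENNReal.toReal_eq_toReal_iff' (measure_ne_top _ _) (measure_ne_top _ _)]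
      simpa [measureReal_def] using hmass
    simp [this]
  | coe a =>
    simp only [EReal.coe_le_coe_iff] at *
    have hc : ∀ μ : Measure Ω, IsFiniteMeasure μ → Integrable (fun _ : Ω => a) μ :=
      fun μ _ => integrable_const a
    -- Compare integrals of `a - f`: it is nonnegative on the truncation event, where `ρ` dominates
    -- `ν`, and negative off it. The constant `a` cancels at the end because the masses agree.
    have h1 : ∫ ω in {ω | f ω ≤ a}, (a - f ω) ∂ν ≤ ∫ ω in {ω | f ω ≤ a}, (a - f ω) ∂ρ := by
      refine integral_mono_measure (Measure.restrict_mono le_rfl hle) ?_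
        ((hc ρ inferInstance).sub hint).integrableOn
      filter_upwards [ae_restrict_mem hA] with ω hω
      exact sub_nonneg.2 hω
    have h2 : ∫ ω, (a - f ω) ∂ν ≤ ∫ ω in {ω | f ω ≤ a}, (a - f ω) ∂ν := by
      rw [← integral_add_compl (f := fun ω => a - f ω) hA ((hc ν inferInstance).sub hintν)]
      have : ∫ ω in {ω | f ω ≤ a}ᶜ, (a - f ω) ∂ν ≤ 0 := by
        refine integral_nonpos_of_ae ?_
        filter_upwards [ae_restrict_mem hA.compl] with ω hω
        have : a < f ω := by simpa using hω
        exact sub_nonpos.2 this.le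
      linarith
    rw [integral_sub (hc ρ inferInstance).integrableOn hint.integrableOn] at h1
    rw [integral_sub (hc ν inferInstance) hintν] at h2
    simp only [integral_const, measureReal_restrict_apply_univ, smul_eq_mul] at h1 h2
    rw [hmass] at h2
    linarith

/-- The complementary component `ν'` has the mass of the lower truncation, so its integral is at
least the lower one; subtract from the total. -/
lemma integral_le_setIntegral_of_add_eq {ρ ν ν' : Measure Ω} [IsFiniteMeasure ρ] {f : Ω → ℝ}
    (hf : Measurable f) (hint : Integrable f ρ) (hadd : ν + ν' = ρ) (a : EReal)
    (hmass : ν.real Set.univ = ρ.real {ω | a < (f ω : EReal)}) :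
    ∫ ω, f ω ∂ν ≤ ∫ ω in {ω | a < (f ω : EReal)}, f ω ∂ρ := by
  have hle : ν ≤ ρ := hadd ▸ Measure.le_add_right le_rfl
  have hle' : ν' ≤ ρ := hadd ▸ Measure.le_add_left le_rfl
  have : IsFiniteMeasure ν := isFiniteMeasure_of_le ρ hle
  have : IsFiniteMeasure ν' := isFiniteMeasure_of_le ρ hle'
  have hA := measurableSet_le_ereal hf a
  have hE : {ω | a < (f ω : EReal)} = {ω | (f ω : EReal) ≤ a}ᶜ := by ext; simp
  have h1 := setIntegral_le_integral_of_le hf hint hle' a <| by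
    have h := measureReal_add_measureReal_compl (μ := ρ) hA
    rw [← hE, ← hmass] at h
    have h' : ρ.real Set.univ = ν.real Set.univ + ν'.real Set.univ := by
      rw [← hadd, measureReal_add_apply]
    linarith
  have h2 : ∫ ω, f ω ∂ρ = ∫ ω, f ω ∂ν + ∫ ω, f ω ∂ν' := by
    rw [← hadd, integral_add_measure (hint.mono_measure hle) (hint.mono_measure hle')]
  have h3 := integral_add_compl hA hint
  rw [hE]
  linarith

end Truncation

/-! ### Cell masses and cell integrals of a joint law -/

section Cells

/-- The event `T = t, Tstar = s, z = k`. -/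
def cell (t s k : Fin 2) : Set Full := fullT t ∩ fullS s ∩ fullZ k

/-- `P(T = t, Tstar = s, z = k)`. -/
def cellMass (Q : Measure Full) (t s k : Fin 2) : ℝ := Q.real (cell t s k)

/-- `E[y; T = t, Tstar = s, z = k]`. -/
def cellSum (Q : Measure Full) (t s k : Fin 2) : ℝ := ∫ w in cell t s k, w.1 ∂Q

/-- The model assumptions in terms of the masses `M t s k` of the cells `T = t, Tstar = s, z = k`
and the integrals `Y t s k` of `y` over them. -/
structure CellModel (θ : Param) (M Y : Fin 2 → Fin 2 → Fin 2 → ℝ) : Prop where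
  α₀_nonneg : 0 ≤ θ.α₀
  α₁_nonneg : 0 ≤ θ.α₁
  α_sum : θ.α₀ + θ.α₁ < 1
  relevance : (M 0 1 1 + M 1 1 1) * (M 0 0 0 + M 1 0 0 + (M 0 1 0 + M 1 1 0)) ≠
    (M 0 1 0 + M 1 1 0) * (M 0 0 1 + M 1 0 1 + (M 0 1 1 + M 1 1 1))
  moment : ∀ k, Y 0 0 k + Y 1 0 k + (Y 0 1 k + Y 1 1 k) =
    θ.c * (M 0 0 k + M 1 0 k + (M 0 1 k + M 1 1 k)) + θ.β * (M 0 1 k + M 1 1 k)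
  mass_α₀ : ∀ k, M 1 0 k = θ.α₀ * (M 0 0 k + M 1 0 k)
  mass_α₁ : ∀ k, M 0 1 k = θ.α₁ * (M 0 1 k + M 1 1 k)
  nondifferential : ∀ t s k, Y t s k * (M 0 s k + M 1 s k) = (Y 0 s k + Y 1 s k) * M t s k

lemma measurable_fullT_var : Measurable fun w : Full => w.2.1 := by fun_prop
lemma measurable_fullS_var : Measurable fun w : Full => w.2.2.1 := by fun_prop
lemma measurable_fullZ_var : Measurable fun w : Full => w.2.2.2 := by fun_prop

lemma measurableSet_fullT (t : Fin 2) : MeasurableSet (fullT t) :=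
  measurableSet_fiber measurable_fullT_var t
lemma measurableSet_fullS (s : Fin 2) : MeasurableSet (fullS s) :=
  measurableSet_fiber measurable_fullS_var s
lemma measurableSet_fullZ (k : Fin 2) : MeasurableSet (fullZ k) :=
  measurableSet_fiber measurable_fullZ_var k
lemma measurableSet_cell (t s k : Fin 2) : MeasurableSet (cell t s k) :=
  ((measurableSet_fullT t).inter (measurableSet_fullS s)).inter (measurableSet_fullZ k)

lemma fullS_inter_fullZ_inter_fullT (t s k : Fin 2) :
    fullS s ∩ fullZ k ∩ fullT t = cell t s k := by
  unfold cell; ext; simp only [Set.mem_inter_iff]; tauto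

lemma fullS_inter_fullT_inter_fullZ (t s k : Fin 2) :
    fullS s ∩ fullT t ∩ fullZ k = cell t s k := by
  unfold cell; ext; simp only [Set.mem_inter_iff]; tauto

variable {Q : Measure Full} [IsFiniteMeasure Q]

lemma measureReal_fullS_inter_fullZ (s k : Fin 2) :
    Q.real (fullS s ∩ fullZ k) = cellMass Q 0 s k + cellMass Q 1 s k := by
  have h := measureReal_eq_add_fibers Q measurable_fullT_var (fullS s ∩ fullZ k)
  change _ = Q.real (_ ∩ fullT 0) + Q.real (_ ∩ fullT 1) at h
  rwa [fullS_inter_fullZ_inter_fullT, fullS_inter_fullZ_inter_fullT] at h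

lemma measureReal_fullZ_inter_fullS (s k : Fin 2) :
    Q.real (fullZ k ∩ fullS s) = cellMass Q 0 s k + cellMass Q 1 s k := by
  rw [Set.inter_comm, measureReal_fullS_inter_fullZ]

lemma measureReal_fullZ (k : Fin 2) :
    Q.real (fullZ k) =
      cellMass Q 0 0 k + cellMass Q 1 0 k + (cellMass Q 0 1 k + cellMass Q 1 1 k) := by
  rw [← measureReal_fullZ_inter_fullS, ← measureReal_fullZ_inter_fullS]
  exact measureReal_eq_add_fibers Q measurable_fullS_var _

lemma measureReal_fullS (s : Fin 2) :
    Q.real (fullS s) =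
      cellMass Q 0 s 0 + cellMass Q 1 s 0 + (cellMass Q 0 s 1 + cellMass Q 1 s 1) := by
  rw [← measureReal_fullS_inter_fullZ, ← measureReal_fullS_inter_fullZ]
  exact measureReal_eq_add_fibers Q measurable_fullZ_var _

lemma measureReal_fullS_inter_fullT (t s : Fin 2) :
    Q.real (fullS s ∩ fullT t) = cellMass Q t s 0 + cellMass Q t s 1 := by
  have h := measureReal_eq_add_fibers Q measurable_fullZ_var (fullS s ∩ fullT t)
  change _ = Q.real (_ ∩ fullZ 0) + Q.real (_ ∩ fullZ 1) at h
  rwa [fullS_inter_fullT_inter_fullZ, fullS_inter_fullT_inter_fullZ] at h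

lemma integrable_err_of_integrable (hy : Integrable (fun w : Full => w.1) Q) (θ : Param) :
    Integrable (err θ) Q := by
  have h : Integrable (fun w : Full => ((w.2.2.1 : ℕ) : ℝ)) Q := by
    refine Integrable.of_bound (C := 1) ?_ (.of_forall fun w => ?_)
    · exact ((measurable_from_top (f := fun i : Fin 2 => ((i : ℕ) : ℝ))).comp
        measurable_fullS_var).aestronglyMeasurable
    · have : (w.2.2.1 : ℕ) ≤ 1 := by omega
      simpa using this
  exact (hy.sub (integrable_const θ.c)).sub (h.const_mul θ.β)

section Integrals

variable (hy : Integrable (fun w : Full => w.1) Q) (θ : Param)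
include hy

lemma setIntegral_err_cell (t s k : Fin 2) :
    ∫ w in cell t s k, err θ w ∂Q =
      cellSum Q t s k - (θ.c + θ.β * ((s : ℕ) : ℝ)) * cellMass Q t s k := by
  have h : ∫ w in cell t s k, err θ w ∂Q =
      ∫ w in cell t s k, (w.1 - (θ.c + θ.β * ((s : ℕ) : ℝ))) ∂Q := by
    refine setIntegral_congr_fun (measurableSet_cell t s k) fun w hw => ?_
    have : w.2.2.1 = s := hw.1.2
    simp only [err, this]
    ring
  rw [h, integral_sub hy.integrableOn (integrable_const _)]
  simp [cellSum, cellMass, mul_comm]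

lemma setIntegral_err_fullS_inter_fullZ (s k : Fin 2) :
    ∫ w in fullS s ∩ fullZ k, err θ w ∂Q = cellSum Q 0 s k + cellSum Q 1 s k -
      (θ.c + θ.β * ((s : ℕ) : ℝ)) * (cellMass Q 0 s k + cellMass Q 1 s k) := by
  have h := setIntegral_eq_add_fibers measurable_fullT_var (integrable_err_of_integrable hy θ)
    (fullS s ∩ fullZ k)
  change _ = ∫ w in _ ∩ fullT 0, _ ∂Q + ∫ w in _ ∩ fullT 1, _ ∂Q at h
  rw [fullS_inter_fullZ_inter_fullT, fullS_inter_fullZ_inter_fullT, setIntegral_err_cell hy,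
    setIntegral_err_cell hy] at h
  rw [h]
  ring

lemma setIntegral_err_fullZ (k : Fin 2) :
    ∫ w in fullZ k, err θ w ∂Q =
      cellSum Q 0 0 k + cellSum Q 1 0 k + (cellSum Q 0 1 k + cellSum Q 1 1 k) -
      (θ.c * (cellMass Q 0 0 k + cellMass Q 1 0 k + (cellMass Q 0 1 k + cellMass Q 1 1 k)) +
        θ.β * (cellMass Q 0 1 k + cellMass Q 1 1 k)) := by
  have h := setIntegral_eq_add_fibers measurable_fullS_var (integrable_err_of_integrable hy θ)
    (fullZ k)
  change _ = ∫ w in fullZ k ∩ fullS 0, _ ∂Q + ∫ w in fullZ k ∩ fullS 1, _ ∂Q at h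
  rw [Set.inter_comm, Set.inter_comm _ (fullS 1), setIntegral_err_fullS_inter_fullZ hy,
    setIntegral_err_fullS_inter_fullZ hy] at h
  rw [h]
  simp
  ring

lemma integral_err :
    ∫ w, err θ w ∂Q = ∫ w in fullZ 0, err θ w ∂Q + ∫ w in fullZ 1, err θ w ∂Q := by
  have h := setIntegral_eq_add_fibers measurable_fullZ_var (integrable_err_of_integrable hy θ)
    Set.univ
  simpa [fullZ] using h

end Integrals

omit [IsFiniteMeasure Q] in
lemma cellMass_nonneg (t s k : Fin 2) : 0 ≤ cellMass Q t s k := measureReal_nonneg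

lemma cellSum_eq_zero {t s k : Fin 2} (h : cellMass Q t s k = 0) : cellSum Q t s k = 0 :=
  setIntegral_measure_zero _ ((measureReal_eq_zero_iff).1 h)

lemma measure_ne_zero_iff_measureReal {E : Set Full} : Q E ≠ 0 ↔ Q.real E ≠ 0 := by
  rw [ne_eq, ne_eq, measureReal_eq_zero_iff]

end Cells

/-! ### Equivalence of the model with its cell equations -/

section Model

variable {Q : Measure Full} {θ : Param}

/-- Clearing denominators turns the conditional statements into polynomial identities. These hold
trivially on null cells, where the model imposes nothing. -/
lemma IsModel.cellModel [IsProbabilityMeasure Q] (h : IsModel Q θ)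
    (hy : Integrable (fun w : Full => w.1) Q) :
    CellModel θ (cellMass Q) (cellSum Q) := by
  have hZ1 : Q.real (fullZ 1) ≠ 0 := h.z_pos.ne'
  have hZ0 : Q.real (fullZ 0) ≠ 0 := by
    have hs := measureReal_eq_add_fibers Q measurable_fullZ_var Set.univ
    change _ = Q.real (_ ∩ fullZ 0) + Q.real (_ ∩ fullZ 1) at hs
    rw [Set.univ_inter, Set.univ_inter, probReal_univ] at hs
    have := h.z_lt_one
    intro h0
    linarith
  have hZ : ∀ k, Q.real (fullZ k) ≠ 0 := Fin.forall_fin_two.2 ⟨hZ0, hZ1⟩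
  have hrate : ∀ (t s k : Fin 2) (a : ℝ), (Q (fullS s ∩ fullZ k) ≠ 0 →
      (Q[|fullS s ∩ fullZ k]).real (fullT t) = a) →
      cellMass Q t s k = a * (cellMass Q 0 s k + cellMass Q 1 s k) := by
    intro t s k a ha
    rw [measure_ne_zero_iff_measureReal,
      real_cond_eq _ ((measurableSet_fullS s).inter (measurableSet_fullZ k)),
      fullS_inter_fullZ_inter_fullT, measureReal_fullS_inter_fullZ] at ha
    by_cases h0 : cellMass Q 0 s k + cellMass Q 1 s k = 0
    · have h1 := cellMass_nonneg (Q := Q) 0 s k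
      have h2 := cellMass_nonneg (Q := Q) 1 s k
      rw [h0, mul_zero]
      revert t
      exact Fin.forall_fin_two.2 ⟨fun _ => by linarith, fun _ => by linarith⟩
    · rw [← ha h0]
      change _ = _⁻¹ * cellMass Q t s k * _
      field_simp
  refine
    { α₀_nonneg := h.α₀_eq ▸ measureReal_nonneg
      α₁_nonneg := h.α₁_eq ▸ measureReal_nonneg
      α_sum := h.α_sum
      relevance := ?_
      moment := fun k => ?_
      mass_α₀ := fun k => hrate 1 0 k _ (h.α₀_homog k)
      mass_α₁ := fun k => hrate 0 1 k _ (h.α₁_homog k)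
      nondifferential := fun t s k => ?_ }
  · have hr := h.relevance
    rw [real_cond_eq _ (measurableSet_fullZ _), real_cond_eq _ (measurableSet_fullZ _),
      measureReal_fullZ_inter_fullS, measureReal_fullZ_inter_fullS] at hr
    rw [← measureReal_fullZ, ← measureReal_fullZ]
    intro he
    apply hr
    field_simp
    linarith
  · have hv := h.validity k
    rw [integral_cond_eq, mul_eq_zero, inv_eq_zero, or_iff_right (hZ k),
      setIntegral_err_fullZ hy] at hv
    linarith
  · by_cases h0 : cellMass Q t s k = 0
    · rw [h0, cellSum_eq_zero h0]; ring
    · have hn := h.nondifferential t s k (measure_ne_zero_iff_measureReal.2 h0)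
      have h1 : cellMass Q 0 s k + cellMass Q 1 s k ≠ 0 := by
        intro h1
        have h2 := cellMass_nonneg (Q := Q) 0 s k
        have h3 := cellMass_nonneg (Q := Q) 1 s k
        apply h0
        revert t
        exact Fin.forall_fin_two.2 ⟨fun _ _ => by linarith, fun _ _ => by linarith⟩
      change ∫ w, err θ w ∂Q[|cell t s k] = _ at hn
      rw [integral_cond_eq, integral_cond_eq, setIntegral_err_cell hy,
        setIntegral_err_fullS_inter_fullZ hy, measureReal_fullS_inter_fullZ] at hn
      change (cellMass Q t s k)⁻¹ * _ = _ at hn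
      field_simp at hn
      linarith

/-- The conditions absent from the cell equations follow by summation over `k`: `E[ε] = 0` from
validity, and the unconditional rates from the rates given `z`. -/
lemma CellModel.isModel [IsProbabilityMeasure Q] (h : CellModel θ (cellMass Q) (cellSum Q))
    (hy : Integrable (fun w : Full => w.1) Q) (hz : 0 < Q.real (fullZ 1))
    (hz' : Q.real (fullZ 1) < 1) : IsModel Q θ := by
  have hZ1 : Q.real (fullZ 1) ≠ 0 := hz.ne'
  have hZ0 : Q.real (fullZ 0) ≠ 0 := by
    have hs := measureReal_eq_add_fibers Q measurable_fullZ_var Set.univ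
    change _ = Q.real (_ ∩ fullZ 0) + Q.real (_ ∩ fullZ 1) at hs
    rw [Set.univ_inter, Set.univ_inter, probReal_univ] at hs
    intro h0
    linarith
  have hM := cellMass_nonneg (Q := Q)
  -- Were `Tstar = s` null, the two sides of the cross-multiplied relevance condition would
  -- coincide.
  have hS : ∀ s, Q.real (fullS s) ≠ 0 := by
    refine Fin.forall_fin_two.2 ⟨fun h0 => ?_, fun h0 => ?_⟩
    all_goals
      rw [measureReal_fullS] at h0
      apply h.relevance
    · have h1 : cellMass Q 0 0 0 + cellMass Q 1 0 0 = 0 := by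
        linarith [hM 0 0 0, hM 1 0 0, hM 0 0 1, hM 1 0 1]
      have h2 : cellMass Q 0 0 1 + cellMass Q 1 0 1 = 0 := by
        linarith [hM 0 0 0, hM 1 0 0, hM 0 0 1, hM 1 0 1]
      rw [h1, h2]; ring
    · have h1 : cellMass Q 0 1 0 + cellMass Q 1 1 0 = 0 := by
        linarith [hM 0 1 0, hM 1 1 0, hM 0 1 1, hM 1 1 1]
      have h2 : cellMass Q 0 1 1 + cellMass Q 1 1 1 = 0 := by
        linarith [hM 0 1 0, hM 1 1 0, hM 0 1 1, hM 1 1 1]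
      rw [h1, h2]; ring
  have herr : ∀ k, ∫ w in fullZ k, err θ w ∂Q = 0 := fun k => by
    rw [setIntegral_err_fullZ hy, h.moment k, sub_self]
  have hrate : ∀ (t s k : Fin 2) (a : ℝ),
      cellMass Q t s k = a * (cellMass Q 0 s k + cellMass Q 1 s k) →
      Q (fullS s ∩ fullZ k) ≠ 0 → (Q[|fullS s ∩ fullZ k]).real (fullT t) = a := by
    intro t s k a ha h0
    rw [measure_ne_zero_iff_measureReal, measureReal_fullS_inter_fullZ] at h0
    rw [real_cond_eq _ ((measurableSet_fullS s).inter (measurableSet_fullZ k)),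
      fullS_inter_fullZ_inter_fullT, measureReal_fullS_inter_fullZ]
    change _⁻¹ * cellMass Q t s k = a
    rw [ha]
    field_simp
  have hrate' : ∀ (t s : Fin 2) (a : ℝ),
      (∀ k, cellMass Q t s k = a * (cellMass Q 0 s k + cellMass Q 1 s k)) →
      a = (Q[|fullS s]).real (fullT t) := by
    intro t s a ha
    have h0 := hS s
    rw [real_cond_eq _ (measurableSet_fullS s), measureReal_fullS_inter_fullT]
    rw [measureReal_fullS] at h0 ⊢
    rw [ha 0, ha 1]
    field_simp
  refine
    { integrable_err := integrable_err_of_integrable hy θ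
      mean_err := by rw [integral_err hy, herr, herr, add_zero]
      z_pos := hz
      z_lt_one := hz'
      relevance := ?_
      validity := fun k => by rw [integral_cond_eq, herr, mul_zero]
      α₀_eq := hrate' 1 0 _ h.mass_α₀
      α₁_eq := hrate' 0 1 _ h.mass_α₁
      α₀_homog := fun k => hrate 1 0 k _ (h.mass_α₀ k)
      α₁_homog := fun k => hrate 0 1 k _ (h.mass_α₁ k)
      α_sum := h.α_sum
      nondifferential := fun t s k h0 => ?_ }
  · rw [real_cond_eq _ (measurableSet_fullZ _), real_cond_eq _ (measurableSet_fullZ _),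
      measureReal_fullZ_inter_fullS, measureReal_fullZ_inter_fullS]
    have hr := h.relevance
    rw [← measureReal_fullZ, ← measureReal_fullZ] at hr
    intro he
    apply hr
    field_simp at he
    linarith
  · have h1 : cellMass Q t s k ≠ 0 := measure_ne_zero_iff_measureReal.1 h0
    have h2 : cellMass Q 0 s k + cellMass Q 1 s k ≠ 0 := by
      intro h2
      apply h1
      clear h0 h1
      revert t
      exact Fin.forall_fin_two.2 ⟨by linarith [hM 0 s k, hM 1 s k],
        by linarith [hM 0 s k, hM 1 s k]⟩
    change ∫ w, err θ w ∂Q[|cell t s k] = _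
    rw [integral_cond_eq, integral_cond_eq, setIntegral_err_cell hy,
      setIntegral_err_fullS_inter_fullZ hy, measureReal_fullS_inter_fullZ]
    change (cellMass Q t s k)⁻¹ * _ = _
    have hn := h.nondifferential t s k
    field_simp
    linarith

end Model

/-! ### Observable moments and components of the observed laws -/

section Observables

/-- `P(T = t, z = k)`. -/
def massTZ (P : Measure Obs) (t k : Fin 2) : ℝ := P.real (evTZ t k)

/-- `E[y; T = t, z = k]`. -/
def sumTZ (P : Measure Obs) (t k : Fin 2) : ℝ := ∫ w in evTZ t k, w.1 ∂P

lemma measurable_obsT : Measurable fun w : Obs => w.2.1 := by fun_prop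
lemma measurable_obsZ : Measurable fun w : Obs => w.2.2 := by fun_prop

lemma measurableSet_evZ (k : Fin 2) : MeasurableSet (evZ k) :=
  measurableSet_fiber measurable_obsZ k

lemma measurableSet_evTZ (t k : Fin 2) : MeasurableSet (evTZ t k) :=
  (measurableSet_fiber measurable_obsT t).inter (measurableSet_fiber measurable_obsZ k)

lemma evZ_inter_fiber (t k : Fin 2) : evZ k ∩ {w : Obs | w.2.1 = t} = evTZ t k :=
  Set.inter_comm _ _

variable {P : Measure Obs}

lemma measureReal_evZ [IsFiniteMeasure P] (k : Fin 2) :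
    P.real (evZ k) = massTZ P 0 k + massTZ P 1 k := by
  rw [measureReal_eq_add_fibers P measurable_obsT, evZ_inter_fiber, evZ_inter_fiber]
  rfl

lemma firstStage_eq [IsFiniteMeasure P] (k : Fin 2) :
    firstStage P k = massTZ P 1 k / (massTZ P 0 k + massTZ P 1 k) := by
  rw [firstStage, real_cond_eq _ (measurableSet_evZ k), evZ_inter_fiber, measureReal_evZ,
    inv_mul_eq_div]
  rfl

lemma meanZ_eq [IsFiniteMeasure P] (hy : Integrable (fun w : Obs => w.1) P) (k : Fin 2) :
    meanZ P k = (sumTZ P 0 k + sumTZ P 1 k) / (massTZ P 0 k + massTZ P 1 k) := by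
  rw [meanZ, integral_cond_eq, measureReal_evZ, setIntegral_eq_add_fibers measurable_obsT hy,
    evZ_inter_fiber, evZ_inter_fiber, inv_mul_eq_div]
  rfl

lemma meanTZ_eq (t k : Fin 2) : meanTZ P t k = sumTZ P t k / massTZ P t k := by
  rw [meanTZ, integral_cond_eq, inv_mul_eq_div]
  rfl

lemma massTZ_pos [IsProbabilityMeasure P] (hz : 0 < P.real (evZ 1) ∧ P.real (evZ 1) < 1)
    (hp : ∀ k, 0 < firstStage P k ∧ firstStage P k < 1) (t k : Fin 2) : 0 < massTZ P t k := by
  have hZ : 0 < P.real (evZ k) := by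
    have hs := measureReal_eq_add_fibers P measurable_obsZ Set.univ
    change _ = P.real (_ ∩ evZ 0) + P.real (_ ∩ evZ 1) at hs
    rw [Set.univ_inter, Set.univ_inter, probReal_univ] at hs
    revert k
    exact Fin.forall_fin_two.2 ⟨by linarith, hz.1⟩
  rw [measureReal_evZ] at hZ
  have h := hp k
  rw [firstStage_eq, div_pos_iff_of_pos_right hZ, div_lt_one hZ] at h
  revert t
  exact Fin.forall_fin_two.2 ⟨by linarith, h.1⟩

section Truncation

variable [IsFiniteMeasure P] {t k : Fin 2} {r : ℝ}

lemma measureReal_restrict_le_quantileTZ (hm : 0 < massTZ P t k)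
    (hc : Continuous (cdfTZ P t k)) (h0 : 0 ≤ r) (h1 : r ≤ 1) :
    (P.restrict (evTZ t k)).real {w | (w.1 : EReal) ≤ quantileTZ P t k r} =
      r * massTZ P t k := by
  have : IsProbabilityMeasure P[|evTZ t k] :=
    cond_isProbabilityMeasure fun h => hm.ne' (by simp [massTZ, measureReal_def, h])
  have h := measureReal_le_quantile P[|evTZ t k] measurable_fst hc h0 h1
  rw [real_cond_eq _ (measurableSet_evTZ t k)] at h
  rw [measureReal_restrict_apply (measurableSet_le_ereal measurable_fst _), Set.inter_comm]
  change (massTZ P t k)⁻¹ * _ = r at h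
  rw [inv_mul_eq_iff_eq_mul₀ hm.ne', mul_comm] at h
  exact h

lemma measureReal_restrict_quantileTZ_lt (hm : 0 < massTZ P t k)
    (hc : Continuous (cdfTZ P t k)) (h0 : 0 ≤ r) (h1 : r ≤ 1) :
    (P.restrict (evTZ t k)).real {w | quantileTZ P t k (1 - r) < (w.1 : EReal)} =
      r * massTZ P t k := by
  have : IsProbabilityMeasure P[|evTZ t k] :=
    cond_isProbabilityMeasure fun h => hm.ne' (by simp [massTZ, measureReal_def, h])
  have h := measureReal_quantile_lt P[|evTZ t k] measurable_fst hc h0 h1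
  rw [real_cond_eq _ (measurableSet_evTZ t k)] at h
  rw [measureReal_restrict_apply
    (measurableSet_lt measurable_const measurable_fst.coe_real_ereal), Set.inter_comm]
  change (massTZ P t k)⁻¹ * _ = r at h
  rw [inv_mul_eq_iff_eq_mul₀ hm.ne', mul_comm] at h
  exact h

lemma lowerMean_quantileTZ (hm : 0 < massTZ P t k)
    (hc : Continuous (cdfTZ P t k)) (h0 : 0 ≤ r) (h1 : r ≤ 1) :
    lowerMean P t k (quantileTZ P t k r) = (r * massTZ P t k)⁻¹ *
      ∫ w in {w | (w.1 : EReal) ≤ quantileTZ P t k r}, w.1 ∂(P.restrict (evTZ t k)) := by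
  have hA := measurableSet_le_ereal (Ω := Obs) measurable_fst (quantileTZ P t k r)
  have h := measureReal_restrict_le_quantileTZ hm hc h0 h1
  rw [lowerMean, integral_cond_eq, Measure.restrict_restrict hA, ← h,
    measureReal_restrict_apply hA]

lemma upperMean_quantileTZ (hm : 0 < massTZ P t k)
    (hc : Continuous (cdfTZ P t k)) (h0 : 0 ≤ r) (h1 : r ≤ 1) :
    upperMean P t k (quantileTZ P t k (1 - r)) = (r * massTZ P t k)⁻¹ *
      ∫ w in {w | quantileTZ P t k (1 - r) < (w.1 : EReal)}, w.1 ∂(P.restrict (evTZ t k)) := by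
  have hA : MeasurableSet {w : Obs | quantileTZ P t k (1 - r) < (w.1 : EReal)} :=
    measurableSet_lt measurable_const measurable_fst.coe_real_ereal
  have h := measureReal_restrict_quantileTZ_lt hm hc h0 h1
  rw [upperMean, integral_cond_eq, Measure.restrict_restrict hA, ← h,
    measureReal_restrict_apply hA]

/-- The mean of a component of weight `r` of the law of `y` given `T = t, z = k` lies between the
truncated means. -/
lemma truncated_means_of_split (hy : Integrable (fun w : Obs => w.1) P) (hm : 0 < massTZ P t k)
    (hc : Continuous (cdfTZ P t k)) (h0 : 0 < r) (h1 : r ≤ 1) {ν₀ ν₁ : Measure Obs}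
    (hadd : ν₁ + ν₀ = P.restrict (evTZ t k)) (hmass : ν₁.real Set.univ = r * massTZ P t k)
    {m : ℝ} (hsum : ∫ w, w.1 ∂ν₁ = r * massTZ P t k * m) :
    lowerMean P t k (quantileTZ P t k r) ≤ m ∧
      m ≤ upperMean P t k (quantileTZ P t k (1 - r)) := by
  have hpos : 0 < r * massTZ P t k := mul_pos h0 hm
  constructor
  · rw [lowerMean_quantileTZ hm hc h0.le h1, inv_mul_le_iff₀ hpos, ← hsum]
    exact setIntegral_le_integral_of_le measurable_fst hy.restrict
      (hadd ▸ Measure.le_add_right le_rfl) _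
      (hmass.trans (measureReal_restrict_le_quantileTZ hm hc h0.le h1).symm)
  · rw [upperMean_quantileTZ hm hc h0.le h1, le_inv_mul_iff₀ hpos, ← hsum]
    exact integral_le_setIntegral_of_add_eq measurable_fst hy.restrict hadd _
      (hmass.trans (measureReal_restrict_quantileTZ_lt hm hc h0.le h1).symm)

/-- Mixing the two truncations gives a component of weight `r` with any mean between the
truncated means. -/
lemma exists_split_of_truncated_means (hy : Integrable (fun w : Obs => w.1) P)
    (hm : 0 < massTZ P t k) (hc : Continuous (cdfTZ P t k)) (h0 : 0 ≤ r) (h1 : r ≤ 1) {m : ℝ}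
    (h : r ≠ 0 → lowerMean P t k (quantileTZ P t k r) ≤ m ∧
      m ≤ upperMean P t k (quantileTZ P t k (1 - r))) :
    ∃ ν₀ ν₁ : Measure Obs, ν₁ + ν₀ = P.restrict (evTZ t k) ∧
      ν₁.real Set.univ = r * massTZ P t k ∧ ∫ w, w.1 ∂ν₁ = r * massTZ P t k * m := by
  by_cases hr : r = 0
  · exact ⟨P.restrict (evTZ t k), 0, by simp, by simp [hr], by simp [hr]⟩
  have hpos : 0 < r * massTZ P t k := mul_pos (lt_of_le_of_ne h0 (Ne.symm hr)) hm
  obtain ⟨hl, hu⟩ := h hr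
  set ρ := P.restrict (evTZ t k) with hρ
  have hyρ : Integrable (fun w : Obs => w.1) ρ := hy.restrict
  set A := {w : Obs | (w.1 : EReal) ≤ quantileTZ P t k r} with hAdef
  set B := {w : Obs | quantileTZ P t k (1 - r) < (w.1 : EReal)} with hBdef
  have hA : MeasurableSet A := measurableSet_le_ereal measurable_fst _
  have hB : MeasurableSet B := measurableSet_lt measurable_const measurable_fst.coe_real_ereal
  have hAm : ρ.real A = r * massTZ P t k := measureReal_restrict_le_quantileTZ hm hc h0 h1
  have hBm : ρ.real B = r * massTZ P t k := measureReal_restrict_quantileTZ_lt hm hc h0 h1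
  rw [lowerMean_quantileTZ hm hc h0 h1, inv_mul_le_iff₀ hpos] at hl
  rw [upperMean_quantileTZ hm hc h0 h1, le_inv_mul_iff₀ hpos] at hu
  obtain ⟨a, b, ha, hb, hab, hmab⟩ :
      r * massTZ P t k * m ∈ segment ℝ (∫ w in A, w.1 ∂ρ) (∫ w in B, w.1 ∂ρ) := by
    rw [segment_eq_Icc (hl.trans hu)]
    exact ⟨hl, hu⟩
  have hab' : ENNReal.ofReal a + ENNReal.ofReal b = 1 := by
    rw [← ENNReal.ofReal_add ha hb, hab, ENNReal.ofReal_one]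
  -- Using the same weights on the complements makes the two components add up to `ρ`, since `a + b
  -- = 1`.
  refine ⟨ENNReal.ofReal a • ρ.restrict Aᶜ + ENNReal.ofReal b • ρ.restrict Bᶜ,
    ENNReal.ofReal a • ρ.restrict A + ENNReal.ofReal b • ρ.restrict B, ?_, ?_, ?_⟩
  · rw [add_add_add_comm, ← smul_add, ← smul_add, Measure.restrict_add_restrict_compl hA,
      Measure.restrict_add_restrict_compl hB, ← add_smul, hab', one_smul]
  · rw [measureReal_add_apply (by simp [ENNReal.mul_eq_top]) (by simp [ENNReal.mul_eq_top]),
      measureReal_ennreal_smul_apply, measureReal_ennreal_smul_apply,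
      measureReal_restrict_apply_univ, measureReal_restrict_apply_univ, hAm, hBm,
      ENNReal.toReal_ofReal ha, ENNReal.toReal_ofReal hb, ← add_mul, hab, one_mul]
  · rw [integral_add_measure (hyρ.restrict.smul_measure ENNReal.ofReal_ne_top)
      (hyρ.restrict.smul_measure ENNReal.ofReal_ne_top), integral_smul_measure,
      integral_smul_measure, ENNReal.toReal_ofReal ha, ENNReal.toReal_ofReal hb, hmab]

omit [IsFiniteMeasure P] in
-- Rescaling a law preserves its mean, so the proportional split needs no truncation bounds. It
-- serves the case of equal conditional means.
lemma exists_split_of_mean (hr0 : 0 ≤ r) (hr1 : r ≤ 1) :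
    ∃ ν₀ ν₁ : Measure Obs, ν₁ + ν₀ = P.restrict (evTZ t k) ∧
      ν₁.real Set.univ = r * massTZ P t k ∧ ∫ w, w.1 ∂ν₁ = r * sumTZ P t k := by
  refine ⟨ENNReal.ofReal (1 - r) • P.restrict (evTZ t k),
    ENNReal.ofReal r • P.restrict (evTZ t k), ?_, ?_, ?_⟩
  · rw [← add_smul, ← ENNReal.ofReal_add hr0 (sub_nonneg.2 hr1), add_sub_cancel,
      ENNReal.ofReal_one, one_smul]
  · rw [measureReal_ennreal_smul_apply, measureReal_restrict_apply_univ,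
      ENNReal.toReal_ofReal hr0]
    rfl
  · rw [integral_smul_measure, ENNReal.toReal_ofReal hr0]
    rfl

end Truncation

end Observables

/-! ### Joint laws as splittings of the observed law -/

section Coupling

/-- The projection of `(y, T, Tstar, z)` to the observables. -/
def toObs (w : Full) : Obs := (w.1, w.2.1, w.2.2.2)

/-- The extension of the observables by `Tstar = s`. -/
def ofObs (s : Fin 2) (w : Obs) : Full := (w.1, w.2.1, s, w.2.2)

lemma measurable_toObs : Measurable toObs := by unfold toObs; fun_prop

lemma measurable_ofObs (s : Fin 2) : Measurable (ofObs s) := by unfold ofObs; fun_prop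

lemma restrict_evTZ_map_toObs (Q : Measure Full) (t k : Fin 2) :
    (Q.restrict (cell t 1 k)).map toObs + (Q.restrict (cell t 0 k)).map toObs =
      (Q.map toObs).restrict (evTZ t k) := by
  rw [Measure.restrict_map measurable_toObs (measurableSet_evTZ t k),
    ← Measure.restrict_inter_add_sdiff (toObs ⁻¹' evTZ t k) (measurableSet_fullS 0),
    Measure.map_add _ _ measurable_toObs, add_comm]
  congr 4
  · unfold cell; ext w
    simp only [Set.mem_inter_iff, Set.mem_preimage]
    exact ⟨fun h => ⟨⟨h.1.1, h.2⟩, h.1.2⟩, fun h => ⟨⟨h.1.1, h.2⟩, h.1.2⟩⟩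
  · rw [fullS, sdiff_fiber_zero]
    unfold cell; ext w
    simp only [Set.mem_inter_iff, Set.mem_preimage]
    exact ⟨fun h => ⟨⟨h.1.1, h.2⟩, h.1.2⟩, fun h => ⟨⟨h.1.1, h.2⟩, h.1.2⟩⟩

lemma measureReal_map_toObs_univ (Q : Measure Full) (t s k : Fin 2) :
    ((Q.restrict (cell t s k)).map toObs).real Set.univ = cellMass Q t s k := by
  rw [map_measureReal_apply measurable_toObs .univ, Set.preimage_univ,
    measureReal_restrict_apply_univ]
  rfl

lemma integral_map_toObs (Q : Measure Full) (t s k : Fin 2) :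
    ∫ w, w.1 ∂((Q.restrict (cell t s k)).map toObs) = cellSum Q t s k := by
  rw [integral_map measurable_toObs.aemeasurable measurable_fst.aestronglyMeasurable]
  rfl

lemma restrict_eq_self_of_le_restrict {Ω : Type*} [MeasurableSpace Ω] {μ ν : Measure Ω}
    {E : Set Ω} (hE : MeasurableSet E) (h : ν ≤ μ.restrict E) : ν.restrict E = ν := by
  refine Measure.restrict_eq_self_of_ae_mem ?_
  exact (Measure.absolutelyContinuous_of_le h).ae_le (ae_restrict_mem hE)

lemma restrict_eq_zero_of_le_restrict {Ω : Type*} [MeasurableSpace Ω] {μ ν : Measure Ω}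
    {E F : Set Ω} (hE : MeasurableSet E) (hF : MeasurableSet F) (hEF : Disjoint E F)
    (h : ν ≤ μ.restrict E) : ν.restrict F = 0 := by
  rw [← restrict_eq_self_of_le_restrict hE h, Measure.restrict_restrict hF,
    hEF.symm.inter_eq, Measure.restrict_empty]

lemma sum_restrict_evTZ (P : Measure Obs) :
    ∑ t, ∑ k, P.restrict (evTZ t k) = P := by
  simp only [Fin.sum_univ_two]
  have hT := Measure.restrict_inter_add_sdiff (μ := P) Set.univ
    (measurableSet_fiber measurable_obsT 0)
  rw [sdiff_fiber_zero, Measure.restrict_univ, Set.univ_inter, Set.univ_inter] at hT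
  have hZ : ∀ t, P.restrict (evTZ t 0) + P.restrict (evTZ t 1) =
      P.restrict {w | w.2.1 = t} := fun t => by
    have h := Measure.restrict_inter_add_sdiff (μ := P) {w : Obs | w.2.1 = t}
      (measurableSet_fiber measurable_obsZ 0)
    rwa [sdiff_fiber_zero] at h
  rw [hZ, hZ, hT]

/-- A family of splits of the observable laws on the events `T = t, z = k` comes from a joint
law. -/
lemma exists_joint_of_split {P : Measure Obs} {ν : Fin 2 → Fin 2 → Fin 2 → Measure Obs}
    (hν : ∀ t k, ν t 1 k + ν t 0 k = P.restrict (evTZ t k)) :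
    ∃ Q : Measure Full, Q.map toObs = P ∧
      ∀ t s k, (Q.restrict (cell t s k)).map toObs = ν t s k := by
  have hcomp : ∀ s, toObs ∘ ofObs s = id := fun s => rfl
  have hle : ∀ t s k, ν t s k ≤ P.restrict (evTZ t k) := by
    intro t s k
    rw [← hν]
    revert s
    exact Fin.forall_fin_two.2 ⟨Measure.le_add_left le_rfl, Measure.le_add_right le_rfl⟩
  have hres : ∀ t s k t' k', (ν t' s k').restrict (evTZ t k) =
      if t' = t ∧ k' = k then ν t s k else 0 := by
    intro t s k t' k'
    split_ifs with h
    · obtain ⟨rfl, rfl⟩ := h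
      exact restrict_eq_self_of_le_restrict (measurableSet_evTZ _ _) (hle _ _ _)
    · refine restrict_eq_zero_of_le_restrict (measurableSet_evTZ t' k')
        (measurableSet_evTZ t k) ?_ (hle _ _ _)
      rw [Set.disjoint_left]
      rintro w ⟨h1, h2⟩ ⟨h3, h4⟩
      exact h ⟨h1.symm.trans h3, h2.symm.trans h4⟩
  -- `N s` is to be the law of the observables on `Tstar = s`; the joint law tags it with `s` and
  -- sums over `s`.
  set N : Fin 2 → Measure Obs := fun s => ∑ t, ∑ k, ν t s k with hN
  have hNres : ∀ t s k, (N s).restrict (evTZ t k) = ν t s k := by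
    intro t s k
    simp only [hN, Fin.sum_univ_two, Measure.restrict_add, hres]
    fin_cases t <;> fin_cases k <;> simp
  refine ⟨(N 0).map (ofObs 0) + (N 1).map (ofObs 1), ?_, fun t s k => ?_⟩
  · rw [Measure.map_add _ _ measurable_toObs, Measure.map_map measurable_toObs
      (measurable_ofObs _), Measure.map_map measurable_toObs (measurable_ofObs _), hcomp, hcomp,
      Measure.map_id, Measure.map_id, ← sum_restrict_evTZ P]
    simp only [hN, ← hν, Fin.sum_univ_two]
    abel
  · have hs : ∀ s', ((N s').map (ofObs s')).restrict (cell t s k) =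
        if s' = s then (ν t s k).map (ofObs s) else 0 := by
      intro s'
      rw [Measure.restrict_map (measurable_ofObs _) (measurableSet_cell _ _ _)]
      split_ifs with h
      · subst h
        have : ofObs s' ⁻¹' cell t s' k = evTZ t k := by
          ext w
          exact ⟨fun h => ⟨h.1.1, h.2⟩, fun h => ⟨⟨h.1, rfl⟩, h.2⟩⟩
        rw [this, hNres]
      · have : ofObs s' ⁻¹' cell t s k = ∅ := by
          ext w
          exact ⟨fun h' => h h'.1.2, False.elim⟩
        rw [this, Measure.restrict_empty, Measure.map_zero]
    have : ((N 0).map (ofObs 0) + (N 1).map (ofObs 1)).restrict (cell t s k) =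
        (ν t s k).map (ofObs s) := by
      rw [Measure.restrict_add, hs, hs]
      fin_cases s <;> simp
    rw [this, Measure.map_map measurable_toObs (measurable_ofObs _), hcomp, Measure.map_id]

end Coupling

/-! ### Misclassification rates applied to integrals -/

section CellAlgebra

variable {θ : Param} {M Y : Fin 2 → Fin 2 → Fin 2 → ℝ}

/-- Given `Tstar = 0, z = k`, the mean of `y` does not depend on `T`, so the subcell `T = 1`, with
share `α₀` of the mass, carries share `α₀` of the integral. -/
lemma CellModel.sum_α₀ (h : CellModel θ M Y) (hM : ∀ t s k, 0 ≤ M t s k)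
    (hMY : ∀ t s k, M t s k = 0 → Y t s k = 0) (k : Fin 2) :
    Y 1 0 k = θ.α₀ * (Y 0 0 k + Y 1 0 k) := by
  by_cases h0 : M 0 0 k + M 1 0 k = 0
  · rw [hMY 0 0 k (by linarith [hM 0 0 k, hM 1 0 k]), hMY 1 0 k (by linarith [hM 0 0 k, hM 1 0 k])]
    ring
  · have h1 := h.nondifferential 1 0 k
    refine mul_right_cancel₀ h0 ?_
    linear_combination h1 + (Y 0 0 k + Y 1 0 k) * h.mass_α₀ k

lemma CellModel.sum_α₁ (h : CellModel θ M Y) (hM : ∀ t s k, 0 ≤ M t s k)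
    (hMY : ∀ t s k, M t s k = 0 → Y t s k = 0) (k : Fin 2) :
    Y 0 1 k = θ.α₁ * (Y 0 1 k + Y 1 1 k) := by
  by_cases h0 : M 0 1 k + M 1 1 k = 0
  · rw [hMY 0 1 k (by linarith [hM 0 1 k, hM 1 1 k]), hMY 1 1 k (by linarith [hM 0 1 k, hM 1 1 k])]
    ring
  · have h1 := h.nondifferential 0 1 k
    refine mul_right_cancel₀ h0 ?_
    linear_combination h1 + (Y 0 1 k + Y 1 1 k) * h.mass_α₁ k

end CellAlgebra

/-! ### Mixing weights and the implied mean -/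

section Weights

variable {P : Measure Obs} [IsFiniteMeasure P] {k : Fin 2} {a b : ℝ}

/-- The probability of `Tstar = 1, z = k` that the first stage implies. -/
def trueMass (P : Measure Obs) (k : Fin 2) (a b : ℝ) : ℝ :=
  (massTZ P 1 k - a * (massTZ P 0 k + massTZ P 1 k)) / (1 - a - b)

variable (hm : ∀ t k, 0 < massTZ P t k)
include hm

lemma trueMass_eq : trueMass P k a b =
    (massTZ P 0 k + massTZ P 1 k) * ((firstStage P k - a) / (1 - a - b)) := by
  have h : massTZ P 0 k + massTZ P 1 k ≠ 0 := (add_pos (hm 0 k) (hm 1 k)).ne'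
  rw [firstStage_eq, trueMass, ← mul_div_assoc]
  congr 1
  field_simp

/-- This is Bayes' rule: `r_{0k}` plays the role of `P(Tstar = 1 | T = 0, z = k)`. -/
lemma mixWeight_zero_mul_mass :
    mixWeight P 0 k a b * massTZ P 0 k = b * trueMass P k a b := by
  have h : massTZ P 0 k + massTZ P 1 k ≠ 0 := (add_pos (hm 0 k) (hm 1 k)).ne'
  have h' : 1 - firstStage P k = massTZ P 0 k / (massTZ P 0 k + massTZ P 1 k) := by
    rw [firstStage_eq]; field_simp; ring
  have := (hm 0 k).ne'
  rw [trueMass_eq hm, mixWeight, if_pos rfl, h']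
  field_simp

lemma mixWeight_one_mul_mass :
    mixWeight P 1 k a b * massTZ P 1 k = (1 - b) * trueMass P k a b := by
  have h : massTZ P 0 k + massTZ P 1 k ≠ 0 := (add_pos (hm 0 k) (hm 1 k)).ne'
  have := (hm 1 k).ne'
  rw [trueMass_eq hm, mixWeight, if_neg (by decide)]
  nth_rw 1 [firstStage_eq]
  field_simp

lemma le_firstStage_iff :
    a ≤ firstStage P k ↔ a * (massTZ P 0 k + massTZ P 1 k) ≤ massTZ P 1 k := by
  rw [firstStage_eq, le_div_iff₀ (add_pos (hm 0 k) (hm 1 k))]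

lemma firstStage_le_iff :
    firstStage P k ≤ a ↔ massTZ P 1 k ≤ a * (massTZ P 0 k + massTZ P 1 k) := by
  rw [firstStage_eq, div_le_iff₀ (add_pos (hm 0 k) (hm 1 k))]

/-- Under the model both sides equal `(1 - α₀ - α₁) E[y; Tstar = 1, z = k]`, which identifies `μ_k`
as the mean given `Tstar = 1`. The product form stays meaningful for other candidate means at `α₀ =
p_k`. -/
lemma muK_mul_mass (hy : Integrable (fun w : Obs => w.1) P) (ha : a < firstStage P k) :
    muK P k a * (massTZ P 1 k - a * (massTZ P 0 k + massTZ P 1 k)) =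
      sumTZ P 1 k - a * (sumTZ P 0 k + sumTZ P 1 k) := by
  have h : massTZ P 0 k + massTZ P 1 k ≠ 0 := (add_pos (hm 0 k) (hm 1 k)).ne'
  have h1 := (hm 1 k).ne'
  have h2 : massTZ P 1 k - a * (massTZ P 0 k + massTZ P 1 k) =
      (massTZ P 0 k + massTZ P 1 k) * (firstStage P k - a) := by
    rw [firstStage_eq]; field_simp
  have h3 : firstStage P k - a ≠ 0 := (sub_pos.2 ha).ne'
  rw [h2, muK, meanTZ_eq, meanZ_eq hy]
  field_simp
  rw [firstStage_eq]
  field_simp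

lemma meanZ_eq_iff (hy : Integrable (fun w : Obs => w.1) P) (c β : ℝ) :
    meanZ P k = c + β * ((firstStage P k - a) / (1 - a - b)) ↔
      sumTZ P 0 k + sumTZ P 1 k =
        c * (massTZ P 0 k + massTZ P 1 k) + β * trueMass P k a b := by
  have h : massTZ P 0 k + massTZ P 1 k ≠ 0 := (add_pos (hm 0 k) (hm 1 k)).ne'
  rw [trueMass_eq hm, meanZ_eq hy, div_eq_iff h]
  constructor <;> intro h <;> linarith

omit [IsFiniteMeasure P] in
lemma meanTZ_eq_iff :
    meanTZ P 0 k = meanTZ P 1 k ↔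
      sumTZ P 0 k * massTZ P 1 k = sumTZ P 1 k * massTZ P 0 k := by
  rw [meanTZ_eq, meanTZ_eq, div_eq_div_iff (hm 0 k).ne' (hm 1 k).ne']

omit [IsFiniteMeasure P] hm in
-- If `a + b ≥ 1`, the interval `[a, 1 - b]` has at most one point, yet it contains two distinct
-- first stages.
lemma add_lt_one_of_mem_firstStageSet (hrel : firstStage P 0 ≠ firstStage P 1)
    (h : (a, b) ∈ firstStageSet P) : a + b < 1 := by
  obtain ⟨h0, h1, h2⟩ := h
  by_contra! hab
  exact hrel (by linarith [(h2 0).1, (h2 0).2, (h2 1).1, (h2 1).2])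

/-- The implied mass of `Tstar = 1` lies between `0` and that of `z = k`. The mass left for `Tstar =
0` is `(1 - a)` or `a` times the difference, for `T = 0` and `T = 1` respectively, hence
nonnegative. -/
lemma mixWeight_mem_Icc (hab : a + b < 1) (h : (a, b) ∈ firstStageSet P) (t : Fin 2) :
    0 ≤ mixWeight P t k a b ∧ mixWeight P t k a b ≤ 1 := by
  obtain ⟨h0, h1, h2⟩ := h
  have hl := (le_firstStage_iff hm).1 (h2 k).1
  have hu := (firstStage_le_iff hm).1 (h2 k).2
  simp only at h0 h1 hl hu
  have hD : 0 < 1 - a - b := by linarith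
  have hS0 : 0 ≤ trueMass P k a b := div_nonneg (by linarith) hD.le
  have hSN : trueMass P k a b ≤ massTZ P 0 k + massTZ P 1 k := by
    rw [trueMass, div_le_iff₀ hD]; linarith
  have hS : trueMass P k a b * (1 - a - b) =
      massTZ P 1 k - a * (massTZ P 0 k + massTZ P 1 k) := div_mul_cancel₀ _ hD.ne'
  have key : 0 ≤ mixWeight P t k a b * massTZ P t k ∧
      mixWeight P t k a b * massTZ P t k ≤ 1 * massTZ P t k := by
    revert t
    refine Fin.forall_fin_two.2 ⟨?_, ?_⟩
    · rw [mixWeight_zero_mul_mass hm]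
      exact ⟨mul_nonneg h1 hS0, by
        nlinarith [mul_nonneg (show (0 : ℝ) ≤ 1 - a by linarith) (sub_nonneg.2 hSN)]⟩
    · rw [mixWeight_one_mul_mass hm]
      exact ⟨mul_nonneg (by linarith) hS0, by nlinarith [mul_nonneg h0 (sub_nonneg.2 hSN)]⟩
  exact ⟨nonneg_of_mul_nonneg_left key.1 (hm t k), le_of_mul_le_mul_right key.2 (hm t k)⟩

end Weights

/-! ### Necessity and sufficiency of the restrictions -/

section Sharpness

variable {P : Measure Obs}

lemma integrable_of_map_toObs {Q : Measure Full} (hQ : Q.map toObs = P)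
    (hy : Integrable (fun w : Obs => w.1) P) : Integrable (fun w : Full => w.1) Q := by
  rw [← hQ, integrable_map_measure measurable_fst.aestronglyMeasurable
    measurable_toObs.aemeasurable] at hy
  exact hy

lemma cellMass_add_cellMass {Q : Measure Full} [IsFiniteMeasure Q] (hQ : Q.map toObs = P)
    (t k : Fin 2) : cellMass Q t 0 k + cellMass Q t 1 k = massTZ P t k := by
  have h := congrArg (fun μ : Measure Obs => μ.real Set.univ) (restrict_evTZ_map_toObs Q t k)
  beta_reduce at h
  rw [hQ, measureReal_add_apply, measureReal_map_toObs_univ, measureReal_map_toObs_univ,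
    measureReal_restrict_apply_univ] at h
  rw [add_comm]
  exact h

lemma cellSum_add_cellSum {Q : Measure Full} (hQ : Q.map toObs = P)
    (hy : Integrable (fun w : Obs => w.1) P) (t k : Fin 2) :
    cellSum Q t 0 k + cellSum Q t 1 k = sumTZ P t k := by
  have hyQ := integrable_of_map_toObs hQ hy
  have hi : ∀ s, Integrable (fun w : Obs => w.1) ((Q.restrict (cell t s k)).map toObs) :=
    fun s => by
      rw [integrable_map_measure measurable_fst.aestronglyMeasurable
        measurable_toObs.aemeasurable]
      exact hyQ.restrict
  rw [sumTZ, ← hQ, ← restrict_evTZ_map_toObs, integral_add_measure (hi 1) (hi 0),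
    integral_map_toObs, integral_map_toObs, add_comm]

lemma measureReal_fullZ_of_map {Q : Measure Full} (hQ : Q.map toObs = P) (k : Fin 2) :
    Q.real (fullZ k) = P.real (evZ k) := by
  rw [← hQ, map_measureReal_apply measurable_toObs (measurableSet_evZ k)]
  rfl

variable [IsProbabilityMeasure P] {θ : Param}

/-- The identified set satisfies the moment conditions and the restrictions on the
misclassification probabilities. -/
lemma restrictions_of_mem_identifiedSet (hy : Integrable (fun w : Obs => w.1) P)
    (hm : ∀ t k, 0 < massTZ P t k) (hcont : ∀ t k, Continuous (cdfTZ P t k))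
    (h : θ ∈ identifiedSet P) :
    θ ∈ paramSet P (firstStageSet P) ∧
      ∀ k, meanTZ P 0 k ≠ meanTZ P 1 k → (θ.α₀, θ.α₁) ∈ setA P k := by
  obtain ⟨Q, _, hQ, hmod⟩ := h
  change Q.map toObs = P at hQ
  have hcell := hmod.cellModel (integrable_of_map_toObs hQ hy)
  have hM := cellMass_nonneg (Q := Q)
  have hMadd := cellMass_add_cellMass hQ
  have hYadd := cellSum_add_cellSum hQ hy
  have hMY : ∀ t s k, cellMass Q t s k = 0 → cellSum Q t s k = 0 := fun t s k =>
    cellSum_eq_zero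
  have hD : 0 < 1 - θ.α₀ - θ.α₁ := by linarith [hcell.α_sum]
  have hS : ∀ k, (1 - θ.α₀ - θ.α₁) * (cellMass Q 0 1 k + cellMass Q 1 1 k) =
      massTZ P 1 k - θ.α₀ * (massTZ P 0 k + massTZ P 1 k) := fun k => by
    rw [← hMadd 0 k, ← hMadd 1 k]
    linarith [hcell.mass_α₀ k, hcell.mass_α₁ k]
  have hS' : ∀ k, (1 - θ.α₀ - θ.α₁) * (cellMass Q 0 0 k + cellMass Q 1 0 k) =
      (1 - θ.α₁) * (massTZ P 0 k + massTZ P 1 k) - massTZ P 1 k := fun k => by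
    rw [← hMadd 0 k, ← hMadd 1 k]
    linarith [hcell.mass_α₀ k, hcell.mass_α₁ k]
  have htrue : ∀ k, trueMass P k θ.α₀ θ.α₁ = cellMass Q 0 1 k + cellMass Q 1 1 k := fun k => by
    rw [trueMass, ← hS, mul_div_cancel_left₀ _ hD.ne']
  have hfs : (θ.α₀, θ.α₁) ∈ firstStageSet P := by
    refine ⟨hcell.α₀_nonneg, hcell.α₁_nonneg, fun k => ⟨?_, ?_⟩⟩
    · rw [le_firstStage_iff hm]
      have := mul_nonneg hD.le (add_nonneg (hM 0 1 k) (hM 1 1 k))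
      linarith [hS k]
    · rw [firstStage_le_iff hm]
      have := mul_nonneg hD.le (add_nonneg (hM 0 0 k) (hM 1 0 k))
      linarith [hS' k]
  refine ⟨⟨fun k => ?_, hfs⟩, fun k hne => ?_⟩
  · rw [meanZ_eq_iff hm hy, htrue, ← hYadd, ← hYadd, ← hMadd, ← hMadd]
    linarith [hcell.moment k]
  have hU0 := hcell.sum_α₀ hM hMY k
  have hU1 := hcell.sum_α₁ hM hMY k
  have hm0 := hcell.mass_α₀ k
  have hm1 := hcell.mass_α₁ k
  rw [ne_eq, meanTZ_eq_iff hm, ← hYadd, ← hYadd, ← hMadd, ← hMadd] at hne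
  -- Equality would make `Tstar = 1` null given `z = k`; then both values of `T` have the mean of
  -- the `Tstar = 0` cells, against `hne`.
  have hlt : θ.α₀ < firstStage P k := by
    refine lt_of_le_of_ne (hfs.2.2 k).1 fun he => hne ?_
    have h1 := hS k
    have h2 := (firstStage_le_iff hm).1 he.ge
    have h3 : cellMass Q 0 1 k + cellMass Q 1 1 k = 0 := by
      refine le_antisymm ?_ (add_nonneg (hM _ _ _) (hM _ _ _))
      exact nonpos_of_mul_nonpos_right (by linarith) hD
    have h4 : cellMass Q 0 1 k = 0 := by linarith [hM 0 1 k, hM 1 1 k]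
    have h5 : cellMass Q 1 1 k = 0 := by linarith [hM 0 1 k, hM 1 1 k]
    rw [h4, h5, hMY _ _ _ h4, hMY _ _ _ h5]
    linear_combination (cellSum Q 0 0 k + cellSum Q 1 0 k) * hm0 -
      (cellMass Q 0 0 k + cellMass Q 1 0 k) * hU0
  have hlt' : firstStage P k < 1 - θ.α₁ := by
    refine lt_of_le_of_ne (hfs.2.2 k).2 fun he => hne ?_
    have h1 := hS' k
    have h2 := (le_firstStage_iff hm).1 he.ge
    have h3 : cellMass Q 0 0 k + cellMass Q 1 0 k = 0 := by
      refine le_antisymm ?_ (add_nonneg (hM _ _ _) (hM _ _ _))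
      exact nonpos_of_mul_nonpos_right (by linarith) hD
    have h4 : cellMass Q 0 0 k = 0 := by linarith [hM 0 0 k, hM 1 0 k]
    have h5 : cellMass Q 1 0 k = 0 := by linarith [hM 0 0 k, hM 1 0 k]
    rw [h4, h5, hMY _ _ _ h4, hMY _ _ _ h5]
    linear_combination (cellMass Q 0 1 k + cellMass Q 1 1 k) * hU1 -
      (cellSum Q 0 1 k + cellSum Q 1 1 k) * hm1
  refine ⟨hfs.1, hfs.2.1, hlt, hlt', fun t ht => ?_⟩
  have hI := mixWeight_mem_Icc hm (k := k) hcell.α_sum hfs t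
  have hmass : cellMass Q t 1 k = mixWeight P t k θ.α₀ θ.α₁ * massTZ P t k := by
    clear ht hI
    revert t
    refine Fin.forall_fin_two.2 ⟨?_, ?_⟩
    · rw [mixWeight_zero_mul_mass hm, htrue]; exact hm1
    · rw [mixWeight_one_mul_mass hm, htrue]; linarith
  have hSpos : 0 < cellMass Q 0 1 k + cellMass Q 1 1 k := by
    have h1 := hS k
    have h2 := (not_congr (firstStage_le_iff hm)).1 hlt.not_ge
    exact pos_of_mul_pos_right (by linarith) hD.le
  have hmu := muK_mul_mass hm hy hlt
  rw [← hS k, ← hYadd, ← hYadd] at hmu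
  -- Hence `μ_k` is the mean of `y` over `Tstar = 1, z = k`, and by non-differential error over each
  -- of its subcells `T = t`.
  have hmu' : muK P k θ.α₀ * (cellMass Q 0 1 k + cellMass Q 1 1 k) =
      cellSum Q 0 1 k + cellSum Q 1 1 k := by
    apply mul_left_cancel₀ hD.ne'
    linarith
  refine truncated_means_of_split hy (hm t k) (hcont t k) (lt_of_le_of_ne hI.1 (Ne.symm ht)) hI.2
    (ν₀ := (Q.restrict (cell t 0 k)).map toObs) (ν₁ := (Q.restrict (cell t 1 k)).map toObs)
    (hQ ▸ restrict_evTZ_map_toObs Q t k) ?_ ?_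
  · rw [measureReal_map_toObs_univ, hmass]
  · rw [integral_map_toObs, ← hmass]
    apply mul_right_cancel₀ hSpos.ne'
    rw [hcell.nondifferential t 1 k, ← hmu']
    ring

/-- Only the `Tstar = 1` components are prescribed, with a mean `m k` common to both `t`; the `Tstar
= 0` conditions follow by subtraction. The mean is abstract because `μ_k` has a zero denominator at
`α₀ = p_k`, which equal conditional means allow. -/
lemma mem_identifiedSet_of_split (hy : Integrable (fun w : Obs => w.1) P)
    (hz : 0 < P.real (evZ 1) ∧ P.real (evZ 1) < 1)
    (hm : ∀ t k, 0 < massTZ P t k) (hrel : firstStage P 0 ≠ firstStage P 1)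
    (hθ : θ ∈ paramSet P (firstStageSet P)) {m : Fin 2 → ℝ}
    (hmean : ∀ k, m k * (massTZ P 1 k - θ.α₀ * (massTZ P 0 k + massTZ P 1 k)) =
      sumTZ P 1 k - θ.α₀ * (sumTZ P 0 k + sumTZ P 1 k))
    (hsplit : ∀ t k, ∃ ν₀ ν₁ : Measure Obs, ν₁ + ν₀ = P.restrict (evTZ t k) ∧
      ν₁.real Set.univ = mixWeight P t k θ.α₀ θ.α₁ * massTZ P t k ∧
      ∫ w, w.1 ∂ν₁ = mixWeight P t k θ.α₀ θ.α₁ * massTZ P t k * m k) :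
    θ ∈ identifiedSet P := by
  obtain ⟨hmom, hfs⟩ := hθ
  have hab := add_lt_one_of_mem_firstStageSet hrel hfs
  have hD : 1 - θ.α₀ - θ.α₁ ≠ 0 := by linarith
  choose ν₀ ν₁ hadd hmass hsum using hsplit
  obtain ⟨Q, hQ, hν⟩ := exists_joint_of_split (P := P)
    (ν := fun t s k => if s = 1 then ν₁ t k else ν₀ t k) (fun t k => by simpa using hadd t k)
  have hprob : IsProbabilityMeasure Q := by
    have : IsProbabilityMeasure (Q.map toObs) := hQ ▸ inferInstance
    exact Measure.isProbabilityMeasure_of_map toObs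
  have hMadd := cellMass_add_cellMass hQ
  have hYadd := cellSum_add_cellSum hQ hy
  have hM1 : ∀ t k, cellMass Q t 1 k = mixWeight P t k θ.α₀ θ.α₁ * massTZ P t k := fun t k => by
    rw [← measureReal_map_toObs_univ, hν, if_pos rfl, hmass]
  have hY1 : ∀ t k, cellSum Q t 1 k = cellMass Q t 1 k * m k := fun t k => by
    rw [← integral_map_toObs, hν, if_pos rfl, hsum, hM1]
  have hM01 : ∀ k, cellMass Q 0 1 k = θ.α₁ * trueMass P k θ.α₀ θ.α₁ := fun k => by
    rw [hM1, mixWeight_zero_mul_mass hm]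
  have hM11 : ∀ k, cellMass Q 1 1 k = (1 - θ.α₁) * trueMass P k θ.α₀ θ.α₁ := fun k => by
    rw [hM1, mixWeight_one_mul_mass hm]
  have hM0 : ∀ t k, cellMass Q t 0 k = massTZ P t k - cellMass Q t 1 k := fun t k =>
    eq_sub_of_add_eq (hMadd t k)
  have hY0 : ∀ t k, cellSum Q t 0 k = sumTZ P t k - cellSum Q t 1 k := fun t k =>
    eq_sub_of_add_eq (hYadd t k)
  have hS : ∀ k, trueMass P k θ.α₀ θ.α₁ * (1 - θ.α₀ - θ.α₁) =
      massTZ P 1 k - θ.α₀ * (massTZ P 0 k + massTZ P 1 k) := fun k => div_mul_cancel₀ _ hD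
  have hmass0 : ∀ k, cellMass Q 1 0 k = θ.α₀ * (cellMass Q 0 0 k + cellMass Q 1 0 k) := by
    intro k
    rw [hM0, hM0, hM01, hM11]
    linear_combination -hS k
  -- The equation for `m k` enters here: the `Tstar = 0` integrals split in the same ratio as the
  -- masses, so their means agree across `T`.
  have hsum0 : ∀ k, cellSum Q 1 0 k = θ.α₀ * (cellSum Q 0 0 k + cellSum Q 1 0 k) := by
    intro k
    rw [hY0, hY0, hY1, hY1, hM01, hM11]
    linear_combination -(m k) * hS k - hmean k
  have hcell : CellModel θ (cellMass Q) (cellSum Q) :=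
    { α₀_nonneg := hfs.1
      α₁_nonneg := hfs.2.1
      α_sum := hab
      relevance := by
        intro he
        apply hrel
        have h0 := (add_pos (hm 0 0) (hm 1 0)).ne'
        have h1 := (add_pos (hm 0 1) (hm 1 1)).ne'
        rw [firstStage_eq, firstStage_eq, div_eq_div_iff h0 h1]
        simp only [hM0, hM01, hM11] at he
        -- `P(Tstar = 1 | z = k)` is affine in `p_k` with the same slope for both `k`, so equal
        -- values would force `p_0 = p_1`.
        linear_combination (1 - θ.α₀ - θ.α₁) * (-he) +
          hS 1 * (massTZ P 0 0 + massTZ P 1 0) - hS 0 * (massTZ P 0 1 + massTZ P 1 1)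
      moment := fun k => by
        have h := (meanZ_eq_iff hm hy _ _).1 (hmom k)
        simp only [hM0, hM01, hM11, hY0]
        linear_combination h
      mass_α₀ := hmass0
      mass_α₁ := fun k => by rw [hM01, hM11]; ring
      nondifferential := fun t s k => by
        revert s
        refine Fin.forall_fin_two.2 ⟨?_, by rw [hY1, hY1, hY1]; ring⟩
        revert t
        refine Fin.forall_fin_two.2 ⟨?_, ?_⟩
        · linear_combination (cellSum Q 0 0 k + cellSum Q 1 0 k) * hmass0 k -
            (cellMass Q 0 0 k + cellMass Q 1 0 k) * hsum0 k
        · linear_combination (cellMass Q 0 0 k + cellMass Q 1 0 k) * hsum0 k -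
            (cellSum Q 0 0 k + cellSum Q 1 0 k) * hmass0 k }
  rw [← measureReal_fullZ_of_map hQ] at hz
  exact ⟨Q, hprob, hQ, hcell.isModel (integrable_of_map_toObs hQ hy) hz.1 hz.2⟩

lemma mem_identifiedSet_of_restrictions (hy : Integrable (fun w : Obs => w.1) P)
    (hz : 0 < P.real (evZ 1) ∧ P.real (evZ 1) < 1)
    (hm : ∀ t k, 0 < massTZ P t k) (hrel : firstStage P 0 ≠ firstStage P 1)
    (hcont : ∀ t k, Continuous (cdfTZ P t k)) (hθ : θ ∈ paramSet P (firstStageSet P))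
    (hA : ∀ k, meanTZ P 0 k ≠ meanTZ P 1 k → (θ.α₀, θ.α₁) ∈ setA P k) :
    θ ∈ identifiedSet P := by
  have hab := add_lt_one_of_mem_firstStageSet hrel hθ.2
  have hI := fun t k => mixWeight_mem_Icc hm (k := k) hab hθ.2 t
  have hk : ∀ k, ∃ m : ℝ, m * (massTZ P 1 k - θ.α₀ * (massTZ P 0 k + massTZ P 1 k)) =
      sumTZ P 1 k - θ.α₀ * (sumTZ P 0 k + sumTZ P 1 k) ∧
      ∀ t, ∃ ν₀ ν₁ : Measure Obs, ν₁ + ν₀ = P.restrict (evTZ t k) ∧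
        ν₁.real Set.univ = mixWeight P t k θ.α₀ θ.α₁ * massTZ P t k ∧
        ∫ w, w.1 ∂ν₁ = mixWeight P t k θ.α₀ θ.α₁ * massTZ P t k * m := by
    intro k
    by_cases he : meanTZ P 0 k = meanTZ P 1 k
    · have hsum : ∀ t, massTZ P t k * meanTZ P 1 k = sumTZ P t k := by
        refine Fin.forall_fin_two.2 ⟨?_, ?_⟩
        · rw [← he, meanTZ_eq, mul_div_cancel₀ _ (hm 0 k).ne']
        · rw [meanTZ_eq, mul_div_cancel₀ _ (hm 1 k).ne']
      -- The common conditional mean solves the mean equation for every `α₀`.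
      refine ⟨meanTZ P 1 k, ?_, fun t => ?_⟩
      · rw [← hsum, ← hsum]; ring
      · rw [mul_assoc _ _ (meanTZ P 1 k), hsum]
        exact exists_split_of_mean (hI t k).1 (hI t k).2
    · obtain ⟨-, -, hlt, -, hb⟩ := hA k he
      exact ⟨muK P k θ.α₀, muK_mul_mass hm hy hlt, fun t =>
        exists_split_of_truncated_means hy (hm t k) (hcont t k) (hI t k).1 (hI t k).2 (hb t)⟩
  choose m hmean hsplit using hk
  exact mem_identifiedSet_of_split hy hz hm hrel hθ hmean fun t k => hsplit k t

end Sharpness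

end

/-- A uniform description, imposing `setA` only at those `k` where the conditional means differ; the
three cases of the theorem are read off from it. -/
lemma identifiedSet_eq {P : Measure Obs} [IsProbabilityMeasure P]
    (hy : Integrable (fun w : Obs => w.1) P)
    (hz : 0 < P.real (evZ 1) ∧ P.real (evZ 1) < 1)
    (hp : ∀ k, 0 < firstStage P k ∧ firstStage P k < 1)
    (hrel : firstStage P 0 ≠ firstStage P 1) (hcont : ∀ t k, Continuous (cdfTZ P t k)) :
    identifiedSet P = {θ | θ ∈ paramSet P (firstStageSet P) ∧
      ∀ k, meanTZ P 0 k ≠ meanTZ P 1 k → (θ.α₀, θ.α₁) ∈ setA P k} := by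
  have hm := massTZ_pos hz hp
  ext θ
  exact ⟨restrictions_of_mem_identifiedSet hy hm hcont,
    fun h => mem_identifiedSet_of_restrictions hy hz hm hrel hcont h.1 h.2⟩

lemma setA_inter_setA_subset (P : Measure Obs) :
    setA P 0 ∩ setA P 1 ⊆ firstStageSet P := fun _ h =>
  ⟨h.1.1, h.1.2.1, Fin.forall_fin_two.2
    ⟨⟨h.1.2.2.1.le, h.1.2.2.2.1.le⟩, ⟨h.2.2.2.1.le, h.2.2.2.2.1.le⟩⟩⟩

/-- `P x` is the conditional law of `(y, T, z)` given that the covariates equal `x`. -/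
theorem theorem2 {X : Type*} [MeasurableSpace X] (P : Kernel X Obs) [IsMarkovKernel P] (x : X)
    (hy : Integrable (fun w : Obs => w.1) (P x))
    (hz : 0 < (P x).real (evZ 1) ∧ (P x).real (evZ 1) < 1)
    (hp : ∀ k, 0 < firstStage (P x) k ∧ firstStage (P x) k < 1)
    (hrel : firstStage (P x) 0 ≠ firstStage (P x) 1)
    (hcont : ∀ t k, Continuous (cdfTZ (P x) t k)) :
    ((∀ k, meanTZ (P x) 0 k ≠ meanTZ (P x) 1 k) →
      identifiedSet (P x) = paramSet (P x) (setA (P x) 0 ∩ setA (P x) 1)) ∧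
    (∀ k l, k ≠ l → meanTZ (P x) 0 k ≠ meanTZ (P x) 1 k →
      meanTZ (P x) 0 l = meanTZ (P x) 1 l →
      identifiedSet (P x) = paramSet (P x) (setA (P x) k ∩ firstStageSet (P x))) ∧
    ((∀ k, meanTZ (P x) 0 k = meanTZ (P x) 1 k) →
      identifiedSet (P x) = paramSet (P x) (firstStageSet (P x))) := by

  rw [identifiedSet_eq hy hz hp hrel hcont]
  refine ⟨fun hne => ?_, fun k l hkl hk hl => ?_, fun heq => ?_⟩
  · ext θ
    constructor
    · rintro ⟨⟨hmom, -⟩, hA⟩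
      exact ⟨hmom, hA 0 (hne 0), hA 1 (hne 1)⟩
    · rintro ⟨hmom, hA⟩
      exact ⟨⟨hmom, setA_inter_setA_subset _ hA⟩,
        Fin.forall_fin_two.2 ⟨fun _ => hA.1, fun _ => hA.2⟩⟩
  · ext θ
    constructor
    · rintro ⟨⟨hmom, hfs⟩, hA⟩
      exact ⟨hmom, hA k hk, hfs⟩
    · rintro ⟨hmom, hA, hfs⟩
      refine ⟨⟨hmom, hfs⟩, fun j hj => ?_⟩
      have hjl : j ≠ l := fun h => hj (h ▸ hl)
      have : j = k := by omega
      exact this ▸ hA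
  · ext θ
    exact ⟨fun h => h.1, fun h => ⟨h, fun k hk => absurd (heq k) hk⟩⟩
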